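/- Consider a two-period overlapping generations economy with young population $N_t=N_0G^t$ ($N_0,G>0$). Let the intensive production function $f:(0,\infty)\to[0,\infty)$ be $C^2$ with $f'>0>f''$; at capital-labor ratio $k$ the wage is $\omega(k)=f(k)-kf'(k)$ and the gross return on capital is $f'(k)$. The young have a $C^2$ quasi-concave utility function $U(c^y,c^o)$ on $(0,\infty)^2$ with $U_1,U_2>0$. For all $k,k'>0$, assume that $\max_{0<c<\omega(k)}U\bigl(c,f'(k')(\omega(k)-c)\bigr)$ has a unique solution, denoted $c^y(k,k')$. For the steady state with capital-labor ratio $k$ let $s=1-\frac{c^y(k,k)+Gk}{\omega(k)}$ be the saving rate, regarded as a function $s(R)$ of $R=f'(k)$. An asset in unit supply pays dividend $D_t=D_0G_d^t$. An equilibrium path is a sequence $(k_t,P_t,D_t)_{t\ge0}$ with $k_t>0$, $P_t\ge0$ and, for all $t$, $$f'(k_{t+1})P_t=P_{t+1}+D_{t+1},\qquad \omega(k_t)-c^y(k_t,k_{t+1})-Gk_{t+1}=P_t/N_t,\qquad D_{t+1}=G_dD_t.$$ Let $\xi_t=(k_t,P_t/N_t,D_t/N_t)$. Suppose $k_f>0$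 satisfies $s(R_f)=0$ and $R_f=f'(k_f)<G$, that $k_b>0$ satisfies $f'(k_b)=G$ and $s(G)>0$, and that $G_d\in(R_f,G)$. Let $\xi_f^*=(k_f,0,0)$ and $\xi_b^*=(k_b,\omega(k_b)-c^y(k_b,k_b)-Gk_b,0)$. Then: (i) There is no equilibrium path with $D_0>0$ such that $\xi_t\to\xi_f^*$. (ii) Let $c^y=c^y(k_b,k_b)$, and suppose that $U$ has a (finite, positive) elasticity of intertemporal substitution $\varepsilon$, defined by $\frac1\varepsilon=-\frac{\partial\log(U_1/U_2)}{\partial\log(c_1/c_2)}$, at the bundle $\bigl(c^y,G(\omega(k_b)-c^y)\bigr)$; that is, at this bundle the derivative on the right takes the same value whether $c_1/c_2$ is varied through $c_1$ alone or through $c_2$ alone (which is automatic if $U$ is homothetic). If $$\varepsilon>1+\frac{G^2}{f''}\,\frac{\omega}{c^y(\omega-c^y)}\qquad\text{at }k_b,$$ then $\xi_b^*$ is locally determinate: there is a neighborhood $V_0$ of $\xi_b^*$ such that, for every neighborhood $V\subseteq V_0$ of $\xi_b^*$ and all $(k_0,D_0)$ sufficiently close to $(k_b,0)$ (depending on $V$),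 there is exactly one equilibrium path with initial values $k_0$, $D_0$ that satisfies $\xi_t\in V$ for all $t$ and converges to $\xi_b^*$. -/

import Mathlib

open Set Filter Topology

/-- Marginal rate of substitution `U₁ / U₂` at the bundle `(c₁, c₂)`. -/
noncomputable def mrs (U : ℝ → ℝ → ℝ) (c₁ c₂ : ℝ) : ℝ :=
  deriv (fun x => U x c₂) c₁ / deriv (fun y => U c₁ y) c₂

/-- `U` has elasticity of intertemporal substitution `ε` at `(c₁, c₂)`:
`1 / ε = - ∂ log (U₁ / U₂) / ∂ log (c₁ / c₂)`. The logarithmic ratio `τ = log (c₁ / c₂)` can be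
varied by moving `c₁` or by moving `c₂`; the derivative with respect to the ratio is meaningful
only if both give the same value, as they always do if `U` is homothetic. -/
structure HasEIS (U : ℝ → ℝ → ℝ) (c₁ c₂ ε : ℝ) : Prop where
  pos : 0 < ε
  vary_young :
    HasDerivAt (fun τ => Real.log (mrs U (c₁ * Real.exp τ) c₂)) (-(1 / ε)) 0
  vary_old :
    HasDerivAt (fun τ => Real.log (mrs U c₁ (c₂ * Real.exp (-τ)))) (-(1 / ε)) 0

/-- The choice `c` of consumption when young is optimal given wage `w` and gross interest rate `R`:
consumption is positive in both periods, the old consume the return on savings `R * (w - c)`, and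
utility is maximal. -/
def IsOptimalYoung (U : ℝ → ℝ → ℝ) (w R c : ℝ) : Prop :=
  c ∈ Ioo 0 w ∧ IsMaxOn (fun x => U x (R * (w - x))) (Ioo 0 w) c

/-- The wage `ω(k) = f(k) - k f'(k)` when labor is paid its marginal product. -/
noncomputable def wage (f : ℝ → ℝ) (k : ℝ) : ℝ := f k - k * deriv f k

/-- The overlapping generations economy with production: intensive production function `f`,
utility function `U`, gross population growth rate `G`, and initial young population `N₀`. -/
structure Economy where
  f : ℝ → ℝ
  U : ℝ → ℝ → ℝ
  G : ℝ
  N₀ : ℝ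
  G_pos : 0 < G
  N₀_pos : 0 < N₀
  f_smooth : ContDiffOn ℝ 2 f (Ioi 0)
  f_nonneg : ∀ k, 0 < k → 0 ≤ f k
  f_deriv_pos : ∀ k, 0 < k → 0 < deriv f k
  f_deriv2_neg : ∀ k, 0 < k → deriv (deriv f) k < 0
  U_smooth : ContDiffOn ℝ 2 (fun c : ℝ × ℝ => U c.1 c.2) (Ioi 0 ×ˢ Ioi 0)
  U_deriv₁_pos : ∀ c₁ c₂, 0 < c₁ → 0 < c₂ → 0 < deriv (fun x => U x c₂) c₁
  U_deriv₂_pos : ∀ c₁ c₂, 0 < c₁ → 0 < c₂ → 0 < deriv (fun y => U c₁ y) c₂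
  U_quasiconcave : QuasiconcaveOn ℝ (Ioi (0 : ℝ) ×ˢ Ioi (0 : ℝ)) (fun c : ℝ × ℝ => U c.1 c.2)
  /-- The problem of the young has exactly one solution, so demand is a function. -/
  exists_unique_optimal : ∀ k k', 0 < k → 0 < k' →
    ∃! c, IsOptimalYoung U (wage f k) (deriv f k') c

namespace Economy

/-- The wage function `ω`. -/
noncomputable def ω (E : Economy) (k : ℝ) : ℝ := wage E.f k

/-- Consumption `c^y(k, k')` of the young when the current capital-labor ratio is `k` and the next
one is `k'`: the solution of the problem of the young at wage `ω(k)` and interest rate `f'(k')`. -/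
noncomputable def cy (E : Economy) (k k' : ℝ) : ℝ :=
  Classical.epsilon (IsOptimalYoung E.U (E.ω k) (deriv E.f k'))

/-- The young population `N_t = N₀ G ^ t`. -/
noncomputable def N (E : Economy) (t : ℕ) : ℝ := E.N₀ * E.G ^ t

/-- The saving rate `s(R)` (demand for the risk-free asset in excess of capital, relative to the
wage) at the constant capital-labor ratio `k`, with `R = f'(k)`. -/
noncomputable def savingRate (E : Economy) (k : ℝ) : ℝ :=
  1 - (E.cy k k + E.G * k) / E.ω k

/-- A path of the capital-labor ratio, the asset price and the dividend. -/
structure Path where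
  k : ℕ → ℝ
  P : ℕ → ℝ
  D : ℕ → ℝ

/-- Equilibrium paths when the dividend grows at the gross rate `Gd`. -/
structure IsEquilibrium (E : Economy) (Gd : ℝ) (x : Path) : Prop where
  k_pos : ∀ t, 0 < x.k t
  P_nonneg : ∀ t, 0 ≤ x.P t
  /-- no arbitrage between capital and the asset -/
  no_arbitrage : ∀ t, deriv E.f (x.k (t + 1)) * x.P t = x.P (t + 1) + x.D (t + 1)
  /-- the asset absorbs the savings in excess of capital -/
  clearing : ∀ t, E.ω (x.k t) - E.cy (x.k t) (x.k (t + 1)) - E.G * x.k (t + 1) = x.P t / E.N t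
  dividend : ∀ t, x.D (t + 1) = Gd * x.D t

/-- The detrended variables `ξ_t = (k_t, P_t / N_t, D_t / N_t)`. -/
noncomputable def ξ (E : Economy) (x : Path) (t : ℕ) : ℝ × ℝ × ℝ :=
  (x.k t, x.P t / E.N t, x.D t / E.N t)

/-- The fundamental steady state `(k_f, 0, 0)`. -/
def fundamentalState (kf : ℝ) : ℝ × ℝ × ℝ := (kf, 0, 0)

/-- The bubbly steady state `(k_b, ω(k_b) - c^y(k_b, k_b) - G k_b, 0)`. -/
noncomputable def bubblyState (E : Economy) (kb : ℝ) : ℝ × ℝ × ℝ :=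
  (kb, E.ω kb - E.cy kb kb - E.G * kb, 0)

/-- Local determinacy of the bubbly steady state, the capital-labor ratio `k₀` and the dividend `D₀`
being predetermined: inside every sufficiently small neighborhood `V` of the steady state, for all
`(k₀, D₀)` sufficiently close to `(k_b, 0)`, exactly one equilibrium path in `V` starts from
`(k₀, D₀)` and converges to the steady state. -/
def IsLocallyDeterminate (E : Economy) (Gd kb : ℝ) : Prop :=
  ∃ V₀ ∈ 𝓝 (E.bubblyState kb), ∀ V ∈ 𝓝 (E.bubblyState kb), V ⊆ V₀ →
    ∀ᶠ z : ℝ × ℝ in 𝓝 (kb, 0),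
      ∃! x : Path, E.IsEquilibrium Gd x ∧ x.k 0 = z.1 ∧ x.D 0 = z.2 ∧
        (∀ t, E.ξ x t ∈ V) ∧ Tendsto (E.ξ x) atTop (𝓝 (E.bubblyState kb))

end Economy

/-!
Near the fundamental steady state the interest rate is below the growth rate of dividends, so that
along an equilibrium path that converges to it the price-dividend ratio would eventually fall by at
least one each period and become negative. This excludes convergence when dividends are positive
(`Economy.not_tendsto_of_deriv_lt`).

For the bubbly steady state, write `H(k, k') = ω(k) - c^y(k, k') - G k'` for the demand for the
asset. Market clearing eliminates the price, and an equilibrium path is a solution of the scalar equation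
`f'(k₁) H(k₀, k₁) = G H(k₁, k₂) + G d₁` with exogenous `d` (`Economy.IsEquilibrium.euler`,
`Economy.isEquilibrium_pathOfCapital`). Let `A` and `-B` be the partial derivatives of `H` at
`(k_b, k_b)` and `p = H(k_b, k_b) > 0`. As `f'(k_b) = G`, the linearization in `x = k - k_b` is
`G A x₀ - (G A + G B - f'' p) x₁ + G B x₂ = G d₁`. Always `A > 0`, and the bound on the elasticity of
substitution says that `B > 0` (`Economy.exists_hasStrictFDerivAt_assetDemand`). Since `f'' < 0`, the
equation is then strictly diagonally dominant: solved for `x₁`, it is a contraction on sequences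
with given `x₀`, both in the supremum norm, which yields uniqueness among all paths that remain near
the steady state (`solution_unique`), and in the norm `sup |x t| / μ ^ t` with `μ < 1` close to `1`,
which yields a small solution converging to the steady state (`exists_decaying_solution`).

The demand `c^y` is strictly differentiable at the steady state: the elasticity of substitution
gives both partial derivatives of `log (U₁ / U₂)`, so that the implicit function theorem solves
the first-order condition, and by quasi-concavity this condition is sufficient for an optimum
(`isOptimalYoung_of_mrs_eq`, `exists_hasStrictFDerivAt_demand`).
-/

/-! ### Bounded solutions of second-order difference equations -/

/-- Existence when the Lipschitz bound is global. In the norm `sup |x t| / μ ^ t` with `μ < 1` close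
to `1` and `μ > γ`, the right-hand side is a contraction and the forcing `d₀ γ ^ t` is bounded, so
the fixed point decays like `μ ^ t`. -/
theorem exists_decaying_solution_of_lipschitz {F : ℝ × ℝ × ℝ × ℝ → ℝ} {α β σ C γ : ℝ}
    (hα : 0 ≤ α) (hβ : 0 ≤ β) (hσ : 0 ≤ σ) (hC : 0 ≤ C) (hsum : α + β + σ < 1)
    (hγ : 0 ≤ γ) (hγ1 : γ < 1)
    (hF : ∀ u v : ℝ × ℝ × ℝ × ℝ, |F u - F v| ≤ α * |u.1 - v.1| + β * |u.2.1 - v.2.1| +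
      σ * |u.2.2.1 - v.2.2.1| + C * |u.2.2.2 - v.2.2.2|)
    (hF0 : F 0 = 0) {r : ℝ} (hr : 0 < r) :
    ∃ δ > 0, ∀ x₀ d₀ : ℝ, |x₀| < δ → |d₀| < δ → ∃ x : ℕ → ℝ, x 0 = x₀ ∧ (∀ t, |x t| ≤ r) ∧
      Tendsto x atTop (𝓝 0) ∧
      ∀ t, x (t + 1) = F (x t, x (t + 1), x (t + 2), d₀ * γ ^ (t + 1)) := by
  obtain ⟨μ, hμγ, hμ1, hq⟩ : ∃ μ, γ < μ ∧ μ < 1 ∧ α / μ + β + σ * μ < 1 := by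
    have hc : ContinuousAt (fun μ : ℝ => α / μ + β + σ * μ) 1 := by
      fun_prop (disch := norm_num)
    have h1 : ∀ᶠ μ in 𝓝[<] (1 : ℝ), α / μ + β + σ * μ < 1 :=
      (hc.eventually_lt continuousAt_const (by simpa using hsum)).filter_mono nhdsWithin_le_nhds
    obtain ⟨μ, hμ, hμ'⟩ := (h1.and (Ioo_mem_nhdsLT hγ1)).exists
    exact ⟨μ, hμ'.1, hμ'.2, hμ⟩
  have hμ : 0 < μ := hγ.trans_lt hμγ
  set q := α / μ + β + σ * μ with hqdef
  have hq0 : 0 ≤ q := by positivity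
  refine ⟨(1 - q) * r / (C + 1), by have := sub_pos.2 hq; positivity, fun x₀ d₀ hx₀ hd₀ => ?_⟩
  have hδ : (1 - q) * r / (C + 1) * (C + 1) = (1 - q) * r := by field_simp
  have hδ0 : 0 ≤ (1 - q) * r / (C + 1) := (abs_nonneg _).trans hx₀.le
  have hx₀r : |x₀| ≤ r := by nlinarith
  have hd₀r : C * |d₀| ≤ (1 - q) * r := by
    nlinarith [mul_le_mul_of_nonneg_left hd₀.le hC]
  -- the arguments of `F` at time `t` in terms of the rescaled sequence
  let A : (ℕ → ℝ) → ℕ → ℝ × ℝ × ℝ × ℝ := fun y t =>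
    (μ ^ t * y t, μ ^ (t + 1) * y (t + 1), μ ^ (t + 2) * y (t + 2), d₀ * γ ^ (t + 1))
  have hdiff : ∀ (y z : BoundedContinuousFunction ℕ ℝ) (t : ℕ),
      |F (A y t) / μ ^ (t + 1) - F (A z t) / μ ^ (t + 1)| ≤ q * dist y z := by
    intro y z t
    have hyz : ∀ s, |y s - z s| ≤ dist y z := fun s => by
      simpa [Real.dist_eq] using BoundedContinuousFunction.dist_coe_le_dist (f := y) (g := z) s
    have h := hF (A y t) (A z t)
    simp only [A, sub_self, abs_zero, mul_zero, add_zero, ← mul_sub, abs_mul, abs_pow,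
      abs_of_pos hμ] at h
    rw [← sub_div, abs_div, abs_of_pos (pow_pos hμ (t + 1)), div_le_iff₀ (by positivity)]
    refine h.trans ?_
    have e : q * dist y z * μ ^ (t + 1) = α * (μ ^ t * dist y z) +
        β * (μ ^ (t + 1) * dist y z) + σ * (μ ^ (t + 2) * dist y z) := by
      rw [hqdef]; field_simp; ring
    rw [e]
    gcongr <;> apply hyz
  have hzero : ∀ t, |F (A (0 : BoundedContinuousFunction ℕ ℝ) t) / μ ^ (t + 1)| ≤ C * |d₀| := by
    intro t
    have h := hF (A (0 : BoundedContinuousFunction ℕ ℝ) t) 0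
    simp only [A, hF0, BoundedContinuousFunction.coe_zero, Pi.zero_apply, mul_zero, Prod.fst_zero,
      Prod.snd_zero, sub_zero, abs_zero, zero_add, abs_mul, abs_pow, abs_of_nonneg hγ] at h
    rw [abs_div, abs_of_pos (pow_pos hμ (t + 1)), div_le_iff₀ (by positivity)]
    simp only [A, BoundedContinuousFunction.coe_zero, Pi.zero_apply, mul_zero]
    refine h.trans ?_
    rw [← mul_assoc]
    gcongr
  have hbound : ∀ (y : BoundedContinuousFunction ℕ ℝ) (t : ℕ),
      |F (A y t) / μ ^ (t + 1)| ≤ q * ‖y‖ + C * |d₀| := by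
    intro y t
    have h1 := hdiff y 0 t
    rw [dist_zero_right] at h1
    have h2 := hzero t
    have h3 := abs_sub_abs_le_abs_sub (F (A y t) / μ ^ (t + 1))
      (F (A (0 : BoundedContinuousFunction ℕ ℝ) t) / μ ^ (t + 1))
    linarith
  let T : BoundedContinuousFunction ℕ ℝ → BoundedContinuousFunction ℕ ℝ := fun y =>
    BoundedContinuousFunction.ofNormedAddCommGroupDiscrete
      (fun t => Nat.casesOn t x₀ fun t => F (A y t) / μ ^ (t + 1))
      (max |x₀| (q * ‖y‖ + C * |d₀|)) (by
        rintro (_ | t)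
        · exact le_max_left _ _
        · exact (hbound y t).trans (le_max_right _ _))
  have hT : ContractingWith ⟨q, hq0⟩ T := by
    refine ⟨by exact_mod_cast hq, LipschitzWith.of_dist_le_mul fun y z => ?_⟩
    refine (BoundedContinuousFunction.dist_le (mul_nonneg hq0 dist_nonneg)).2 ?_
    rintro (_ | t)
    · simpa [T] using mul_nonneg hq0 dist_nonneg
    · exact hdiff y z t
  obtain ⟨y, hy⟩ : ∃ y, T y = y := ⟨hT.fixedPoint, hT.fixedPoint_isFixedPt⟩
  have hy0 : y 0 = x₀ := by rw [← hy]; rfl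
  have hys : ∀ t, y (t + 1) = F (A y t) / μ ^ (t + 1) := fun t => by
    conv_lhs => rw [← hy]
    rfl
  have hyr : ‖y‖ ≤ r := by
    have h : ‖y‖ ≤ max |x₀| (q * ‖y‖ + C * |d₀|) := by
      refine (BoundedContinuousFunction.norm_le ((abs_nonneg _).trans (le_max_left _ _))).2 ?_
      rintro (_ | t)
      · rw [hy0]; exact le_max_left _ _
      · rw [hys]; exact (hbound y t).trans (le_max_right _ _)
    rcases le_max_iff.1 h with h | h
    · exact h.trans hx₀r
    · nlinarith
  have hyt : ∀ t, |μ ^ t * y t| ≤ μ ^ t * r := fun t => by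
    rw [abs_mul, abs_of_pos (pow_pos hμ t)]
    gcongr
    exact (y.norm_coe_le_norm t).trans hyr
  have hlim : Tendsto (fun t => μ ^ t * r) atTop (𝓝 0) := by
    simpa using (tendsto_pow_atTop_nhds_zero_of_lt_one hμ.le hμ1).mul_const r
  refine ⟨fun t => μ ^ t * y t, by simp [hy0], fun t => ?_, squeeze_zero_norm hyt hlim, fun t => ?_⟩
  · exact (hyt t).trans (mul_le_of_le_one_left hr.le (pow_le_one₀ hμ.le hμ1.le))
  · change μ ^ (t + 1) * y (t + 1) = F (A y t)
    rw [hys t]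
    field_simp

/-- Existence when the Lipschitz bound holds on the box of radius `ρ`: clamping the arguments to the
box makes it global, and solutions bounded by `r ≤ ρ` are not affected. -/
theorem exists_decaying_solution {F : ℝ × ℝ × ℝ × ℝ → ℝ} {α β σ C γ ρ : ℝ}
    (hα : 0 ≤ α) (hβ : 0 ≤ β) (hσ : 0 ≤ σ) (hC : 0 ≤ C) (hsum : α + β + σ < 1)
    (hγ : 0 ≤ γ) (hγ1 : γ < 1) (hρ : 0 < ρ)
    (hF : ∀ u v : ℝ × ℝ × ℝ × ℝ, ‖u‖ ≤ ρ → ‖v‖ ≤ ρ →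
      |F u - F v| ≤ α * |u.1 - v.1| + β * |u.2.1 - v.2.1| +
        σ * |u.2.2.1 - v.2.2.1| + C * |u.2.2.2 - v.2.2.2|)
    (hF0 : F 0 = 0) {r : ℝ} (hr : 0 < r) (hrρ : r ≤ ρ) :
    ∃ δ > 0, ∀ x₀ d₀ : ℝ, |x₀| < δ → |d₀| < δ → ∃ x : ℕ → ℝ, x 0 = x₀ ∧ (∀ t, |x t| ≤ r) ∧
      Tendsto x atTop (𝓝 0) ∧
      ∀ t, x (t + 1) = F (x t, x (t + 1), x (t + 2), d₀ * γ ^ (t + 1)) := by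
  let p : ℝ → ℝ := fun a => projIcc (-ρ) ρ (by linarith) a
  have hp : ∀ a, |p a| ≤ ρ := fun a => abs_le.2 (projIcc (-ρ) ρ (by linarith) a).2
  have hp' : ∀ a, |a| ≤ ρ → p a = a := fun a ha => by
    simp only [p]; rw [projIcc_of_mem _ (abs_le.1 ha)]
  have hpl : ∀ a b, |p a - p b| ≤ |a - b| := fun a b => abs_projIcc_sub_projIcc _
  let P : ℝ × ℝ × ℝ × ℝ → ℝ × ℝ × ℝ × ℝ := fun u => (p u.1, p u.2.1, p u.2.2.1, p u.2.2.2)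
  have hP : ∀ u, ‖P u‖ ≤ ρ := fun u => by simp [P, Prod.norm_def, hp]
  obtain ⟨δ, hδ, h⟩ := exists_decaying_solution_of_lipschitz (F := F ∘ P) hα hβ hσ hC hsum hγ hγ1
    (fun u v => (hF _ _ (hP u) (hP v)).trans <|
      add_le_add (add_le_add (add_le_add (mul_le_mul_of_nonneg_left (hpl _ _) hα)
        (mul_le_mul_of_nonneg_left (hpl _ _) hβ)) (mul_le_mul_of_nonneg_left (hpl _ _) hσ))
        (mul_le_mul_of_nonneg_left (hpl _ _) hC))
    (by have h0 : p 0 = 0 := hp' 0 (by simpa using hρ.le)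
        have : P 0 = 0 := by simp [P, h0]
        simp [this, hF0]) hr
  refine ⟨min δ ρ, lt_min hδ hρ, fun x₀ d₀ hx₀ hd₀ => ?_⟩
  obtain ⟨x, hx0, hxr, hlim, hx⟩ :=
    h x₀ d₀ (hx₀.trans_le (min_le_left _ _)) (hd₀.trans_le (min_le_left _ _))
  refine ⟨x, hx0, hxr, hlim, fun t => ?_⟩
  have hd : |d₀ * γ ^ (t + 1)| ≤ ρ := by
    rw [abs_mul, abs_of_nonneg (pow_nonneg hγ (t + 1))]
    exact (mul_le_of_le_one_right (abs_nonneg _) (pow_le_one₀ hγ hγ1.le)).trans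
      (hd₀.le.trans (min_le_right _ _))
  refine (hx t).trans ?_
  simp only [Function.comp, P, hp' _ ((hxr _).trans hrρ), hp' _ hd]

/-- Two solutions in the box with the same initial value agree: the supremum `S` of their distance
satisfies `S ≤ (α + β + σ) * S`. -/
theorem solution_unique {F : ℝ × ℝ × ℝ × ℝ → ℝ} {α β σ C ρ : ℝ}
    (hα : 0 ≤ α) (hβ : 0 ≤ β) (hσ : 0 ≤ σ) (hsum : α + β + σ < 1)
    (hF : ∀ u v : ℝ × ℝ × ℝ × ℝ, ‖u‖ ≤ ρ → ‖v‖ ≤ ρ →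
      |F u - F v| ≤ α * |u.1 - v.1| + β * |u.2.1 - v.2.1| +
        σ * |u.2.2.1 - v.2.2.1| + C * |u.2.2.2 - v.2.2.2|)
    {d x y : ℕ → ℝ} (hd : ∀ t, |d t| ≤ ρ) (hx : ∀ t, |x t| ≤ ρ) (hy : ∀ t, |y t| ≤ ρ)
    (h0 : x 0 = y 0)
    (hxs : ∀ t, x (t + 1) = F (x t, x (t + 1), x (t + 2), d (t + 1)))
    (hys : ∀ t, y (t + 1) = F (y t, y (t + 1), y (t + 2), d (t + 1))) : x = y := by
  have hb : BddAbove (range fun t => |x t - y t|) :=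
    ⟨ρ + ρ, by rintro _ ⟨t, rfl⟩; exact (abs_sub _ _).trans (add_le_add (hx t) (hy t))⟩
  set S := ⨆ t, |x t - y t| with hS
  have hle : ∀ t, |x t - y t| ≤ S := le_ciSup hb
  have hS0 : 0 ≤ S := (abs_nonneg _).trans (hle 0)
  have hqS : S ≤ (α + β + σ) * S := by
    refine ciSup_le ?_
    rintro (_ | t)
    · simpa [h0] using mul_nonneg (by positivity) hS0
    · have h := hF (x t, x (t + 1), x (t + 2), d (t + 1)) (y t, y (t + 1), y (t + 2), d (t + 1))
        (by simp [Prod.norm_def, hx, hd]) (by simp [Prod.norm_def, hy, hd])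
      rw [← hxs, ← hys] at h
      simp only [sub_self, abs_zero, mul_zero, add_zero] at h
      calc _ ≤ _ := h
        _ ≤ α * S + β * S + σ * S := by gcongr <;> apply hle
        _ = _ := by ring
  ext t
  have : S ≤ 0 := by nlinarith
  exact sub_eq_zero.1 (abs_eq_zero.1 (le_antisymm ((hle t).trans this) (abs_nonneg _)))

/-- A function whose strict derivative at `0` has total weight less than `1` on the first three
coordinates satisfies the Lipschitz bound required above on a small box. -/
theorem exists_lipschitz_box {F : ℝ × ℝ × ℝ × ℝ → ℝ} {F' : ℝ × ℝ × ℝ × ℝ →L[ℝ] ℝ} {α σ κ : ℝ}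
    (hF : HasStrictFDerivAt F F' 0) (hF' : ∀ u, F' u = α * u.1 + σ * u.2.2.1 + κ * u.2.2.2)
    (hα : 0 ≤ α) (hσ : 0 ≤ σ) (hsum : α + σ < 1) :
    ∃ ρ > 0, ∃ η > 0, (α + η) + η + (σ + η) < 1 ∧ ∀ u v : ℝ × ℝ × ℝ × ℝ, ‖u‖ ≤ ρ → ‖v‖ ≤ ρ →
      |F u - F v| ≤ (α + η) * |u.1 - v.1| + η * |u.2.1 - v.2.1| +
        (σ + η) * |u.2.2.1 - v.2.2.1| + (|κ| + η) * |u.2.2.2 - v.2.2.2| := by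
  set η := (1 - (α + σ)) / 4 with hη
  have hη0 : 0 < η := by rw [hη]; linarith
  obtain ⟨s, hs, happ⟩ := hF.approximates_deriv_on_nhds (c := ⟨η, hη0.le⟩) (Or.inr hη0)
  obtain ⟨ρ, hρ, hball⟩ := Metric.nhds_basis_closedBall.mem_iff.1 hs
  refine ⟨ρ, hρ, η, hη0, by rw [hη]; linarith, fun u v hu hv => ?_⟩
  have h := happ u (hball (by simpa using hu)) v (hball (by simpa using hv))
  have hn : ‖u - v‖ ≤ |u.1 - v.1| + |u.2.1 - v.2.1| + |u.2.2.1 - v.2.2.1| + |u.2.2.2 - v.2.2.2| := by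
    have h1 := abs_nonneg (u.1 - v.1)
    have h2 := abs_nonneg (u.2.1 - v.2.1)
    have h3 := abs_nonneg (u.2.2.1 - v.2.2.1)
    have h4 := abs_nonneg (u.2.2.2 - v.2.2.2)
    simp only [Prod.norm_def, Real.norm_eq_abs, Prod.fst_sub, Prod.snd_sub, max_le_iff]
    refine ⟨?_, ?_, ?_, ?_⟩ <;> linarith
  have h' : |F u - F v - F' (u - v)| ≤ η * ‖u - v‖ := h
  rw [hF'] at h'
  simp only [Prod.fst_sub, Prod.snd_sub] at h'
  have htri : |F u - F v| ≤ |F u - F v - (α * (u.1 - v.1) + σ * (u.2.2.1 - v.2.2.1) +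
      κ * (u.2.2.2 - v.2.2.2))| + (α * |u.1 - v.1| + σ * |u.2.2.1 - v.2.2.1| +
      |κ| * |u.2.2.2 - v.2.2.2|) := by
    have h3 := abs_add_three (α * (u.1 - v.1)) (σ * (u.2.2.1 - v.2.2.1)) (κ * (u.2.2.2 - v.2.2.2))
    rw [abs_mul, abs_mul, abs_mul, abs_of_nonneg hα, abs_of_nonneg hσ] at h3
    have h4 := abs_sub_abs_le_abs_sub (F u - F v) (α * (u.1 - v.1) + σ * (u.2.2.1 - v.2.2.1) +
      κ * (u.2.2.2 - v.2.2.2))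
    linarith
  nlinarith [mul_le_mul_of_nonneg_left hn hη0.le]

/-! ### The problem of the young -/

theorem quadrant_isOpen : IsOpen (Ioi (0 : ℝ) ×ˢ Ioi (0 : ℝ)) := isOpen_Ioi.prod isOpen_Ioi

theorem quadrant_mem_nhds {c : ℝ × ℝ} (h₁ : 0 < c.1) (h₂ : 0 < c.2) :
    Ioi (0 : ℝ) ×ˢ Ioi (0 : ℝ) ∈ 𝓝 c := quadrant_isOpen.mem_nhds ⟨h₁, h₂⟩

section Partials

variable {U : ℝ → ℝ → ℝ}

theorem hasFDerivAt_utility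
    (hU : ContDiffOn ℝ 2 (fun c : ℝ × ℝ => U c.1 c.2) (Ioi 0 ×ˢ Ioi 0)) {c : ℝ × ℝ}
    (h₁ : 0 < c.1) (h₂ : 0 < c.2) :
    HasFDerivAt (fun c : ℝ × ℝ => U c.1 c.2) (fderiv ℝ (fun c : ℝ × ℝ => U c.1 c.2) c) c :=
  ((hU.contDiffAt (quadrant_mem_nhds h₁ h₂)).differentiableAt (by norm_num)).hasFDerivAt

theorem deriv_young_eq
    (hU : ContDiffOn ℝ 2 (fun c : ℝ × ℝ => U c.1 c.2) (Ioi 0 ×ˢ Ioi 0)) {c : ℝ × ℝ}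
    (h₁ : 0 < c.1) (h₂ : 0 < c.2) :
    deriv (fun x => U x c.2) c.1 = fderiv ℝ (fun c : ℝ × ℝ => U c.1 c.2) c (1, 0) :=
  (HasFDerivAt.comp_hasDerivAt (f := fun x => (x, c.2)) c.1 (hasFDerivAt_utility hU h₁ h₂)
    ((hasDerivAt_id c.1).prodMk (hasDerivAt_const c.1 c.2))).deriv

theorem deriv_old_eq
    (hU : ContDiffOn ℝ 2 (fun c : ℝ × ℝ => U c.1 c.2) (Ioi 0 ×ˢ Ioi 0)) {c : ℝ × ℝ}
    (h₁ : 0 < c.1) (h₂ : 0 < c.2) :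
    deriv (fun y => U c.1 y) c.2 = fderiv ℝ (fun c : ℝ × ℝ => U c.1 c.2) c (0, 1) :=
  (HasFDerivAt.comp_hasDerivAt (f := fun y => (c.1, y)) c.2 (hasFDerivAt_utility hU h₁ h₂)
    ((hasDerivAt_const c.2 c.1).prodMk (hasDerivAt_id c.2))).deriv

theorem fderiv_utility_apply
    (hU : ContDiffOn ℝ 2 (fun c : ℝ × ℝ => U c.1 c.2) (Ioi 0 ×ˢ Ioi 0)) {c : ℝ × ℝ}
    (h₁ : 0 < c.1) (h₂ : 0 < c.2) (v : ℝ × ℝ) :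
    fderiv ℝ (fun c : ℝ × ℝ => U c.1 c.2) c v =
      v.1 * deriv (fun x => U x c.2) c.1 + v.2 * deriv (fun y => U c.1 y) c.2 := by
  rw [deriv_young_eq hU h₁ h₂, deriv_old_eq hU h₁ h₂, ← smul_eq_mul, ← smul_eq_mul, ← map_smul,
    ← map_smul, ← map_add]
  simp

theorem contDiffAt_log_mrs
    (hU : ContDiffOn ℝ 2 (fun c : ℝ × ℝ => U c.1 c.2) (Ioi 0 ×ˢ Ioi 0))
    (hU₁ : ∀ c₁ c₂, 0 < c₁ → 0 < c₂ → 0 < deriv (fun x => U x c₂) c₁)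
    (hU₂ : ∀ c₁ c₂, 0 < c₁ → 0 < c₂ → 0 < deriv (fun y => U c₁ y) c₂) {c : ℝ × ℝ}
    (h₁ : 0 < c.1) (h₂ : 0 < c.2) :
    ContDiffAt ℝ 1 (fun c : ℝ × ℝ => Real.log (mrs U c.1 c.2)) c := by
  have hd : ContDiffAt ℝ 1 (fderiv ℝ (fun c : ℝ × ℝ => U c.1 c.2)) c :=
    (hU.fderiv_of_isOpen quadrant_isOpen (by norm_num)).contDiffAt (quadrant_mem_nhds h₁ h₂)
  have hy : ContDiffAt ℝ 1 (fun c : ℝ × ℝ => deriv (fun x => U x c.2) c.1) c :=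
    (hd.clm_apply contDiffAt_const).congr_of_eventuallyEq <| by
      filter_upwards [quadrant_mem_nhds h₁ h₂] with p hp using deriv_young_eq hU hp.1 hp.2
  have ho : ContDiffAt ℝ 1 (fun c : ℝ × ℝ => deriv (fun y => U c.1 y) c.2) c :=
    (hd.clm_apply contDiffAt_const).congr_of_eventuallyEq <| by
      filter_upwards [quadrant_mem_nhds h₁ h₂] with p hp using deriv_old_eq hU hp.1 hp.2
  exact (hy.div ho (hU₂ _ _ h₁ h₂).ne').log (div_pos (hU₁ _ _ h₁ h₂) (hU₂ _ _ h₁ h₂)).ne'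

/-- The elasticity of intertemporal substitution determines both partial derivatives of
`log (U₁ / U₂)`. -/
theorem fderiv_log_mrs_apply
    (hU : ContDiffOn ℝ 2 (fun c : ℝ × ℝ => U c.1 c.2) (Ioi 0 ×ˢ Ioi 0))
    (hU₁ : ∀ c₁ c₂, 0 < c₁ → 0 < c₂ → 0 < deriv (fun x => U x c₂) c₁)
    (hU₂ : ∀ c₁ c₂, 0 < c₁ → 0 < c₂ → 0 < deriv (fun y => U c₁ y) c₂) {c₁ c₂ ε : ℝ}
    (h₁ : 0 < c₁) (h₂ : 0 < c₂) (hε : HasEIS U c₁ c₂ ε) (v : ℝ × ℝ) :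
    fderiv ℝ (fun c : ℝ × ℝ => Real.log (mrs U c.1 c.2)) (c₁, c₂) v =
      1 / ε * (v.2 / c₂ - v.1 / c₁) := by
  set ℓ := fun c : ℝ × ℝ => Real.log (mrs U c.1 c.2)
  have hℓ : HasFDerivAt ℓ (fderiv ℝ ℓ (c₁, c₂)) (c₁, c₂) :=
    ((contDiffAt_log_mrs hU hU₁ hU₂ (c := (c₁, c₂)) h₁ h₂).differentiableAt
      (by norm_num)).hasFDerivAt
  have hy : fderiv ℝ ℓ (c₁, c₂) (c₁, 0) = -(1 / ε) := by
    have hc : HasDerivAt (fun τ : ℝ => (c₁ * Real.exp τ, c₂)) (c₁, 0) 0 := by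
      simpa using ((Real.hasDerivAt_exp 0).const_mul c₁).prodMk (hasDerivAt_const (0 : ℝ) c₂)
    exact (HasFDerivAt.comp_hasDerivAt_of_eq 0 hℓ hc (by simp)).unique hε.vary_young
  have ho : fderiv ℝ ℓ (c₁, c₂) (0, -c₂) = -(1 / ε) := by
    have hc : HasDerivAt (fun τ : ℝ => (c₁, c₂ * Real.exp (-τ))) (0, -c₂) 0 := by
      simpa using (hasDerivAt_const (0 : ℝ) c₁).prodMk
        (((hasDerivAt_id (0 : ℝ)).neg.exp).const_mul c₂)
    exact (HasFDerivAt.comp_hasDerivAt_of_eq 0 hℓ hc (by simp)).unique hε.vary_old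
  have hv : v = (v.1 / c₁) • (c₁, (0 : ℝ)) + (-(v.2 / c₂)) • ((0 : ℝ), -c₂) := by
    ext
    · simp; field_simp
    · simp; field_simp
  conv_lhs => rw [hv]
  rw [map_add, map_smul, map_smul, hy, ho]
  simp only [smul_eq_mul]
  ring

/-- The first-order condition is necessary at an interior optimum. -/
theorem IsOptimalYoung.mrs_eq
    (hU : ContDiffOn ℝ 2 (fun c : ℝ × ℝ => U c.1 c.2) (Ioi 0 ×ˢ Ioi 0))
    (hU₂ : ∀ c₁ c₂, 0 < c₁ → 0 < c₂ → 0 < deriv (fun y => U c₁ y) c₂) {w R c : ℝ}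
    (hR : 0 < R) (hc : IsOptimalYoung U w R c) : mrs U c (R * (w - c)) = R := by
  obtain ⟨⟨h0, hw⟩, hmax⟩ := hc
  have h₂ : 0 < R * (w - c) := mul_pos hR (sub_pos.2 hw)
  have hcurve : HasDerivAt (fun x : ℝ => (x, R * (w - x))) (1, -R) c := by
    simpa using (hasDerivAt_id c).prodMk (((hasDerivAt_id c).const_sub w).const_mul R)
  have hd := HasFDerivAt.comp_hasDerivAt (f := fun x : ℝ => (x, R * (w - x))) c
    (hasFDerivAt_utility hU (c := (c, R * (w - c))) h0 h₂) hcurve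
  have hz := (hmax.isLocalMax (Ioo_mem_nhds h0 hw)).hasDerivAt_eq_zero hd
  rw [fderiv_utility_apply hU h0 h₂] at hz
  have := hU₂ _ _ h0 h₂
  rw [mrs, div_eq_iff this.ne']
  simp only at hz
  linarith

/-- The first-order condition is sufficient. If `y` were strictly better than `c`, so would be the
bundle `Y` with slightly less of both goods; by quasi-concavity utility does not fall
below its value at `c` on the segment towards `Y`, although its derivative in this
direction is negative, since the budget line is tangent to the indifference curve. -/
theorem isOptimalYoung_of_mrs_eq
    (hU : ContDiffOn ℝ 2 (fun c : ℝ × ℝ => U c.1 c.2) (Ioi 0 ×ˢ Ioi 0))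
    (hU₁ : ∀ c₁ c₂, 0 < c₁ → 0 < c₂ → 0 < deriv (fun x => U x c₂) c₁)
    (hU₂ : ∀ c₁ c₂, 0 < c₁ → 0 < c₂ → 0 < deriv (fun y => U c₁ y) c₂)
    (hq : QuasiconcaveOn ℝ (Ioi (0 : ℝ) ×ˢ Ioi (0 : ℝ)) (fun c : ℝ × ℝ => U c.1 c.2))
    {w R c : ℝ} (hR : 0 < R) (hc : c ∈ Ioo 0 w) (h : mrs U c (R * (w - c)) = R) :
    IsOptimalYoung U w R c := by
  refine ⟨hc, fun y hy => ?_⟩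
  by_contra hlt
  have hlt : U c (R * (w - c)) < U y (R * (w - y)) := not_le.1 hlt
  have hc₂ : 0 < R * (w - c) := mul_pos hR (sub_pos.2 hc.2)
  have hy₂ : 0 < R * (w - y) := mul_pos hR (sub_pos.2 hy.2)
  have hcont : ContinuousAt (fun s : ℝ => (y - s, R * (w - y) - s)) 0 := by fun_prop
  have hUc : ContinuousAt (fun c : ℝ × ℝ => U c.1 c.2) (y - 0, R * (w - y) - 0) :=
    (hasFDerivAt_utility hU (by simpa using hy.1) (by simpa using hy₂)).continuousAt
  have hev : ∀ᶠ s in 𝓝[>] (0 : ℝ), U c (R * (w - c)) < U (y - s) (R * (w - y) - s) :=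
    nhdsWithin_le_nhds <| (ContinuousAt.comp (f := fun s : ℝ => (y - s, R * (w - y) - s)) (x := 0) hUc
      hcont).eventually_const_lt (by simpa using hlt)
  have hev' : ∀ᶠ s in 𝓝[>] (0 : ℝ), s < y ∧ s < R * (w - y) :=
    nhdsWithin_le_nhds <| (eventually_lt_nhds hy.1).and (eventually_lt_nhds hy₂)
  obtain ⟨s, ⟨hs, hsy, hsy₂⟩, hs0⟩ := ((hev.and hev').and self_mem_nhdsWithin).exists
  have hs0 : 0 < s := hs0
  set X : ℝ × ℝ := (c, R * (w - c)) with hX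
  set Y : ℝ × ℝ := (y - s, R * (w - y) - s) with hY
  have hseg : segment ℝ X Y ⊆ {z | z ∈ Ioi (0 : ℝ) ×ˢ Ioi (0 : ℝ) ∧ U c (R * (w - c)) ≤ U z.1 z.2} :=
    (hq (U c (R * (w - c)))).segment_subset ⟨⟨hc.1, hc₂⟩, le_rfl⟩
      ⟨⟨sub_pos.2 hsy, sub_pos.2 hsy₂⟩, hs.le⟩
  have hmin : IsLocalMinOn (fun c : ℝ × ℝ => U c.1 c.2) (segment ℝ X Y) X :=
    eventually_of_mem self_mem_nhdsWithin fun z hz => (hseg hz).2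
  have hnn := hmin.hasFDerivWithinAt_nonneg
    (hasFDerivAt_utility hU (c := X) hc.1 hc₂).hasFDerivWithinAt
    (sub_mem_posTangentConeAt_of_segment_subset Subset.rfl)
  rw [fderiv_utility_apply hU hc.1 hc₂] at hnn
  have p₁ := hU₁ _ _ hc.1 hc₂
  have p₂ := hU₂ _ _ hc.1 hc₂
  rw [mrs, div_eq_iff p₂.ne'] at h
  simp only [hX, hY, Prod.fst_sub, Prod.snd_sub] at hnn
  rw [h] at hnn p₁
  nlinarith [mul_pos hs0 p₁, mul_pos hs0 p₂]

/-- Near an optimum at which `U` has an elasticity of intertemporal substitution, there is an optimal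
choice that is a strictly differentiable function of the wage and the interest rate. It
solves the first-order condition `log (U₁ / U₂) = log R`, whose derivative with respect to `c` is
`-(1 / ε) * (1 / c + 1 / (w - c))`. -/
theorem exists_hasStrictFDerivAt_demand
    (hU : ContDiffOn ℝ 2 (fun c : ℝ × ℝ => U c.1 c.2) (Ioi 0 ×ˢ Ioi 0))
    (hU₁ : ∀ c₁ c₂, 0 < c₁ → 0 < c₂ → 0 < deriv (fun x => U x c₂) c₁)
    (hU₂ : ∀ c₁ c₂, 0 < c₁ → 0 < c₂ → 0 < deriv (fun y => U c₁ y) c₂)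
    (hq : QuasiconcaveOn ℝ (Ioi (0 : ℝ) ×ˢ Ioi (0 : ℝ)) (fun c : ℝ × ℝ => U c.1 c.2))
    {w R c ε : ℝ} (hR : 0 < R) (hc : IsOptimalYoung U w R c) (hε : HasEIS U c (R * (w - c)) ε) :
    ∃ (ψ : ℝ × ℝ → ℝ) (ψ' : ℝ × ℝ →L[ℝ] ℝ), HasStrictFDerivAt ψ ψ' (w, R) ∧
      (∀ v, ψ' v = c / w * v.1 + (1 - ε) * (c * (w - c)) / (R * w) * v.2) ∧
      ∀ᶠ q in 𝓝 (w, R), IsOptimalYoung U q.1 q.2 (ψ q) := by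
  have hc0 : 0 < c := hc.1.1
  have hwc : 0 < w - c := sub_pos.2 hc.1.2
  have hw : 0 < w := hc0.trans hc.1.2
  have hε0 : 0 < ε := hε.pos
  set ℓ := fun c : ℝ × ℝ => Real.log (mrs U c.1 c.2) with hℓdef
  have hℓ : HasStrictFDerivAt ℓ (fderiv ℝ ℓ (c, R * (w - c))) (c, R * (w - c)) :=
    (contDiffAt_log_mrs hU hU₁ hU₂ (c := (c, R * (w - c))) hc0 (mul_pos hR hwc)).hasStrictFDerivAt
      (by norm_num)
  -- the first-order condition in the variables `((w, R), c)`
  let Φ : (ℝ × ℝ) × ℝ → ℝ := fun z => ℓ (z.2, z.1.2 * (z.1.1 - z.2)) - Real.log z.1.2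
  let u : (ℝ × ℝ) × ℝ := ((w, R), c)
  obtain ⟨Φ', hΦ, hΦ'⟩ : ∃ Φ' : (ℝ × ℝ) × ℝ →L[ℝ] ℝ, HasStrictFDerivAt Φ Φ' u ∧
      ∀ v, Φ' v = 1 / ε * ((v.1.2 * (w - c) + R * (v.1.1 - v.2)) / (R * (w - c)) - v.2 / c) -
        v.1.2 / R := by
    have h1 : HasStrictFDerivAt (fun z : (ℝ × ℝ) × ℝ => z.1.1)
        ((ContinuousLinearMap.fst ℝ ℝ ℝ).comp (ContinuousLinearMap.fst ℝ (ℝ × ℝ) ℝ)) u :=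
      hasStrictFDerivAt_fst.comp u hasStrictFDerivAt_fst
    have h2 : HasStrictFDerivAt (fun z : (ℝ × ℝ) × ℝ => z.1.2)
        ((ContinuousLinearMap.snd ℝ ℝ ℝ).comp (ContinuousLinearMap.fst ℝ (ℝ × ℝ) ℝ)) u :=
      hasStrictFDerivAt_snd.comp u hasStrictFDerivAt_fst
    have h3 : HasStrictFDerivAt (fun z : (ℝ × ℝ) × ℝ => z.2)
        (ContinuousLinearMap.snd ℝ (ℝ × ℝ) ℝ) u := hasStrictFDerivAt_snd
    have h4 := HasStrictFDerivAt.comp (g := ℓ) u hℓ (h3.prodMk (h2.mul (h1.sub h3)))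
    refine ⟨_, h4.sub (h2.log hR.ne'), fun v => ?_⟩
    simp only [sub_apply, ContinuousLinearMap.comp_apply,
      smul_apply]
    rw [fderiv_log_mrs_apply hU hU₁ hU₂ hc0 (mul_pos hR hwc) hε]
    simp [u]
    ring
  have hΦu : Φ u = 0 := by
    simp only [Φ, u, hℓdef]
    rw [hc.mrs_eq hU hU₂ hR, sub_self]
  have hinv : (Φ' ∘L .inr ℝ (ℝ × ℝ) ℝ).IsInvertible := by
    have ha : -(1 / ε * (1 / (w - c) + 1 / c)) ≠ 0 := by
      have : 0 < 1 / ε * (1 / (w - c) + 1 / c) := by positivity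
      linarith
    refine ⟨ContinuousLinearEquiv.unitsEquivAut ℝ (Units.mk0 _ ha), ?_⟩
    ext
    simp [hΦ']
    field_simp
    ring
  let ψ := hΦ.implicitFunctionOfProdDomain hinv
  have hψ : HasStrictFDerivAt ψ _ (w, R) := hΦ.hasStrictFDerivAt_implicitFunctionOfProdDomain hinv
  have hψt : Tendsto ψ (𝓝 (w, R)) (𝓝 c) := hΦ.tendsto_implicitFunctionOfProdDomain hinv
  have hψ0 : ∀ᶠ q in 𝓝 (w, R), Φ (q, ψ q) = 0 := by
    simpa [hΦu] using hΦ.eventually_apply_implicitFunctionOfProdDomain hinv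
  have hψu : ψ (w, R) = c := tendsto_nhds_unique (hψ.continuousAt.tendsto) hψt
  refine ⟨ψ, _, hψ, fun v => ?_, ?_⟩
  · generalize (-(Φ' ∘L .inr ℝ (ℝ × ℝ) ℝ).inverse ∘L (Φ' ∘L .inl ℝ (ℝ × ℝ) ℝ)) = ψ' at hψ
    have hΦ'' : HasFDerivAt Φ Φ' ((w, R), ψ (w, R)) := by rw [hψu]; exact hΦ.hasFDerivAt
    have hcomp := HasFDerivAt.comp (g := Φ) (f := fun q => (q, ψ q)) (w, R) hΦ''
      ((hasFDerivAt_id (w, R)).prodMk hψ.hasFDerivAt)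
    have hzero := hcomp.unique
      ((hasFDerivAt_const (0 : ℝ) (w, R)).congr_of_eventuallyEq hψ0)
    have hv := DFunLike.congr_fun hzero v
    simp only [ContinuousLinearMap.comp_apply, ContinuousLinearMap.prod_apply,
      ContinuousLinearMap.id_apply, zero_apply, hΦ'] at hv
    field_simp at hv ⊢
    linarith
  · have e1 : ∀ᶠ q in 𝓝 (w, R), 0 < ψ q := hψt.eventually_const_lt hc0
    have e2 : ∀ᶠ q in 𝓝 (w, R), ψ q < q.1 :=
      hψt.eventually_lt continuousAt_fst.tendsto hc.1.2
    have e3 : ∀ᶠ q in 𝓝 (w, R), 0 < q.2 := continuousAt_snd.eventually_const_lt hR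
    filter_upwards [hψ0, e1, e2, e3] with q h0 h1 h2 h3
    refine isOptimalYoung_of_mrs_eq hU hU₁ hU₂ hq h3 ⟨h1, h2⟩ ?_
    have h4 : 0 < q.2 * (q.1 - ψ q) := mul_pos h3 (sub_pos.2 h2)
    exact Real.log_injOn_pos (div_pos (hU₁ _ _ h1 h4) (hU₂ _ _ h1 h4)) h3 (sub_eq_zero.1 h0)

end Partials

namespace Economy

/-! ### The demand for the asset -/

theorem isOptimalYoung_cy (E : Economy) {k k' : ℝ} (hk : 0 < k) (hk' : 0 < k') :
    IsOptimalYoung E.U (E.ω k) (deriv E.f k') (E.cy k k') :=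
  Classical.epsilon_spec (E.exists_unique_optimal k k' hk hk').exists

theorem cy_eq_of_isOptimalYoung (E : Economy) {k k' c : ℝ} (hk : 0 < k) (hk' : 0 < k')
    (hc : IsOptimalYoung E.U (E.ω k) (deriv E.f k') c) : E.cy k k' = c :=
  (E.exists_unique_optimal k k' hk hk').unique (E.isOptimalYoung_cy hk hk') hc

theorem hasStrictDerivAt_deriv_f (E : Economy) {k : ℝ} (hk : 0 < k) :
    HasStrictDerivAt (deriv E.f) (deriv (deriv E.f) k) k :=
  ((E.f_smooth.deriv_of_isOpen isOpen_Ioi (m := 1) (by norm_num)).contDiffAt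
    (Ioi_mem_nhds hk)).hasStrictDerivAt (by norm_num)

theorem hasStrictDerivAt_ω (E : Economy) {k : ℝ} (hk : 0 < k) :
    HasStrictDerivAt E.ω (-(k * deriv (deriv E.f) k)) k := by
  have hf : HasStrictDerivAt E.f (deriv E.f k) k :=
    (E.f_smooth.contDiffAt (Ioi_mem_nhds hk)).hasStrictDerivAt (by norm_num)
  have h : HasStrictDerivAt E.ω _ k :=
    hf.sub ((hasStrictDerivAt_id k).mul (E.hasStrictDerivAt_deriv_f hk))
  exact h.congr_deriv (by simp)

/-- The asset demand per young person, savings in excess of capital: in equilibrium it equals the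
detrended asset price. -/
noncomputable def assetDemand (E : Economy) (k k' : ℝ) : ℝ := E.ω k - E.cy k k' - E.G * k'

theorem assetDemand_pos (E : Economy) {k : ℝ} (hk : 0 < k) (hs : 0 < E.savingRate k) :
    0 < E.assetDemand k k := by
  have hc := (E.isOptimalYoung_cy hk hk).1
  have hw : 0 < E.ω k := hc.1.trans hc.2
  rw [savingRate, sub_pos, div_lt_one hw] at hs
  rw [assetDemand]
  linarith

/-- Strict derivative of the asset demand at a steady state. It increases with the current
capital-labor ratio through the wage. The lower bound on the elasticity of substitution says exactly that it
decreases with the next one. -/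
theorem exists_hasStrictFDerivAt_assetDemand (E : Economy) {k ε : ℝ} (hk : 0 < k)
    (hε : HasEIS E.U (E.cy k k) (deriv E.f k * (E.ω k - E.cy k k)) ε)
    (hbound : ε > 1 + deriv E.f k * E.G / deriv (deriv E.f) k *
      (E.ω k / (E.cy k k * (E.ω k - E.cy k k)))) :
    ∃ A > 0, ∃ B > 0, ∃ H' : ℝ × ℝ →L[ℝ] ℝ,
      HasStrictFDerivAt (fun q : ℝ × ℝ => E.assetDemand q.1 q.2) H' (k, k) ∧
      ∀ v, H' v = A * v.1 - B * v.2 := by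
  have hopt := E.isOptimalYoung_cy hk hk
  have hR := E.f_deriv_pos k hk
  have hf2 := E.f_deriv2_neg k hk
  obtain ⟨ψ, ψ', hψ, hψ', hψopt⟩ := exists_hasStrictFDerivAt_demand E.U_smooth E.U_deriv₁_pos
    E.U_deriv₂_pos E.U_quasiconcave hR hopt hε
  set c := E.cy k k
  set w := E.ω k
  set R := deriv E.f k
  set f₂ := deriv (deriv E.f) k
  have hc : 0 < c := hopt.1.1
  have hwc : 0 < w - c := sub_pos.2 hopt.1.2
  have hw0 : 0 < w := hc.trans hopt.1.2
  have h1 : HasStrictFDerivAt (fun q : ℝ × ℝ => E.ω q.1) _ (k, k) :=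
    (E.hasStrictDerivAt_ω hk).hasStrictFDerivAt.comp (k, k) hasStrictFDerivAt_fst
  have h2 : HasStrictFDerivAt (fun q : ℝ × ℝ => deriv E.f q.2) _ (k, k) :=
    (E.hasStrictDerivAt_deriv_f hk).hasStrictFDerivAt.comp (k, k) hasStrictFDerivAt_snd
  have h12 := h1.prodMk h2
  have h3 := HasStrictFDerivAt.comp (g := ψ) (k, k) hψ h12
  have hcy : (fun q : ℝ × ℝ => ψ (E.ω q.1, deriv E.f q.2)) =ᶠ[𝓝 (k, k)]
      fun q => E.cy q.1 q.2 := by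
    filter_upwards [h12.continuousAt.eventually hψopt, quadrant_mem_nhds (c := (k, k)) hk hk]
      with q hq hpos
    exact (E.cy_eq_of_isOptimalYoung hpos.1 hpos.2 hq).symm
  have h4 := (h1.sub (h3.congr_of_eventuallyEq hcy)).sub
    ((hasStrictFDerivAt_snd (𝕜 := ℝ) (p := (k, k))).const_mul E.G)
  refine ⟨(1 - c / w) * (k * -f₂), ?_, E.G + (1 - ε) * (c * (w - c)) / (R * w) * f₂, ?_, _, h4,
    fun v => ?_⟩
  · have : 0 < 1 - c / w := sub_pos.2 ((div_lt_one hw0).2 hopt.1.2)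
    have : 0 < -f₂ := neg_pos.2 hf2
    positivity
  · have hp : 0 < c * (w - c) / (R * w) * -f₂ := by
      have : 0 < -f₂ := neg_pos.2 hf2
      positivity
    have hmul := mul_lt_mul_of_pos_right hbound hp
    have e : (1 + R * E.G / f₂ * (w / (c * (w - c)))) * (c * (w - c) / (R * w) * -f₂) =
        c * (w - c) / (R * w) * -f₂ - E.G := by
      have := hf2.ne
      field_simp
      ring
    rw [e] at hmul
    have e' : (1 - ε) * (c * (w - c)) / (R * w) * f₂ =
        ε * (c * (w - c) / (R * w) * -f₂) - c * (w - c) / (R * w) * -f₂ := by ring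
    linarith
  · simp [hψ']
    ring

/-! ### Equilibrium paths as solutions of a second-order difference equation -/

theorem N_pos (E : Economy) (t : ℕ) : 0 < E.N t := mul_pos E.N₀_pos (pow_pos E.G_pos t)

theorem N_succ (E : Economy) (t : ℕ) : E.N (t + 1) = E.N t * E.G := by
  rw [N, N, pow_succ, mul_assoc]

theorem IsEquilibrium.D_eq {E : Economy} {Gd : ℝ} {x : Path} (hx : E.IsEquilibrium Gd x) (t : ℕ) :
    x.D t = x.D 0 * Gd ^ t := by
  induction t with
  | zero => simp
  | succ t ih => rw [hx.dividend, ih]; ring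

theorem IsEquilibrium.P_eq {E : Economy} {Gd : ℝ} {x : Path} (hx : E.IsEquilibrium Gd x) (t : ℕ) :
    x.P t = E.N t * E.assetDemand (x.k t) (x.k (t + 1)) := by
  rw [assetDemand, hx.clearing, mul_div_cancel₀ _ (E.N_pos t).ne']

theorem detrended_dividend (E : Economy) (D Gd : ℝ) (t : ℕ) :
    D * Gd ^ t / E.N t = D / E.N₀ * (Gd / E.G) ^ t := by
  rw [N, div_pow, mul_div_mul_comm]

/-- The price can be eliminated: the capital-labor ratio alone solves a difference equation. -/
theorem IsEquilibrium.euler {E : Economy} {Gd : ℝ} {x : Path} (hx : E.IsEquilibrium Gd x) (t : ℕ) :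
    deriv E.f (x.k (t + 1)) * E.assetDemand (x.k t) (x.k (t + 1)) =
      E.G * E.assetDemand (x.k (t + 1)) (x.k (t + 2)) +
        E.G * (x.D 0 / E.N₀ * (Gd / E.G) ^ (t + 1)) := by
  have h := hx.no_arbitrage t
  rw [hx.P_eq, hx.P_eq (t + 1), hx.D_eq, ← div_mul_cancel₀ (x.D 0 * Gd ^ (t + 1))
    (E.N_pos (t + 1)).ne', E.detrended_dividend, N_succ] at h
  refine mul_left_cancel₀ (E.N_pos t).ne' ?_
  linear_combination h

/-- The path with given capital-labor ratios, prices clearing the asset market. -/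
noncomputable def pathOfCapital (E : Economy) (Gd D₀ : ℝ) (k : ℕ → ℝ) : Path where
  k := k
  P t := E.N t * E.assetDemand (k t) (k (t + 1))
  D t := D₀ * Gd ^ t

theorem ξ_pathOfCapital (E : Economy) (Gd D₀ : ℝ) (k : ℕ → ℝ) (t : ℕ) :
    E.ξ (E.pathOfCapital Gd D₀ k) t =
      (k t, E.assetDemand (k t) (k (t + 1)), D₀ / E.N₀ * (Gd / E.G) ^ t) := by
  simp only [ξ, pathOfCapital, E.detrended_dividend, mul_div_cancel_left₀ _ (E.N_pos t).ne']

theorem isEquilibrium_pathOfCapital (E : Economy) {Gd D₀ : ℝ} {k : ℕ → ℝ} (hk : ∀ t, 0 < k t)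
    (hP : ∀ t, 0 ≤ E.assetDemand (k t) (k (t + 1)))
    (h : ∀ t, deriv E.f (k (t + 1)) * E.assetDemand (k t) (k (t + 1)) =
      E.G * E.assetDemand (k (t + 1)) (k (t + 2)) + E.G * (D₀ / E.N₀ * (Gd / E.G) ^ (t + 1))) :
    E.IsEquilibrium Gd (E.pathOfCapital Gd D₀ k) where
  k_pos := hk
  P_nonneg t := mul_nonneg (E.N_pos t).le (hP t)
  no_arbitrage t := by
    have hD := E.detrended_dividend D₀ Gd (t + 1)
    rw [div_eq_iff (E.N_pos (t + 1)).ne'] at hD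
    simp only [pathOfCapital]
    rw [hD, N_succ]
    linear_combination E.N t * h t
  clearing t := by
    simp only [pathOfCapital]
    rw [mul_div_cancel_left₀ _ (E.N_pos t).ne', assetDemand]
  dividend t := by simp only [pathOfCapital]; ring

/-- An equilibrium path is determined by its capital-labor ratios and the initial dividend. -/
theorem IsEquilibrium.ext_capital {E : Economy} {Gd : ℝ} {x : Path} (hx : E.IsEquilibrium Gd x) :
    x = E.pathOfCapital Gd (x.D 0) x.k := by
  have hP : x.P = (E.pathOfCapital Gd (x.D 0) x.k).P := funext hx.P_eq
  have hD : x.D = (E.pathOfCapital Gd (x.D 0) x.k).D := funext hx.D_eq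
  cases x
  simp only [pathOfCapital, Path.mk.injEq, true_and] at hP hD ⊢
  exact ⟨hP, hD⟩

/-! ### The fundamental steady state -/

/-- If the interest rate is eventually below the dividend growth rate, the price-dividend ratio
`P t / D t` eventually falls by at least `1` each period and cannot stay nonnegative. -/
theorem not_tendsto_of_deriv_lt (E : Economy) {k Gd : ℝ} (hk : 0 < k) (hGd : deriv E.f k < Gd)
    {x : Path} (hx : E.IsEquilibrium Gd x) (hD : 0 < x.D 0) : ¬ Tendsto x.k atTop (𝓝 k) := by
  intro hlim
  have hGd0 : 0 < Gd := (E.f_deriv_pos k hk).trans hGd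
  have hDpos : ∀ t, 0 < x.D t := fun t => by rw [hx.D_eq]; positivity
  obtain ⟨T, hT⟩ := eventually_atTop.1 <|
    ((E.hasStrictDerivAt_deriv_f hk).hasDerivAt.continuousAt.tendsto.comp hlim).eventually_lt_const
      hGd
  have hstep : ∀ t, T ≤ t → x.P (t + 1) / x.D (t + 1) ≤ x.P t / x.D t - 1 := by
    intro t ht
    have hR : deriv E.f (x.k (t + 1)) ≤ Gd := (hT (t + 1) (by omega)).le
    have h1 := hx.no_arbitrage t
    have h2 := mul_le_mul_of_nonneg_right hR (hx.P_nonneg t)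
    rw [div_le_iff₀ (hDpos (t + 1)), sub_mul, one_mul]
    have h3 : x.P t / x.D t * x.D (t + 1) = Gd * x.P t := by
      rw [hx.dividend]
      have := (hDpos t).ne'
      field_simp
    linarith
  have hiter : ∀ n : ℕ, x.P (T + n) / x.D (T + n) ≤ x.P T / x.D T - n := by
    intro n
    induction n with
    | zero => simp
    | succ n ih =>
      have := hstep (T + n) (by omega)
      rw [← add_assoc]
      push_cast
      linarith
  obtain ⟨n, hn⟩ := exists_nat_gt (x.P T / x.D T)
  have := div_nonneg (hx.P_nonneg (T + n)) (hDpos (T + n)).le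
  linarith [hiter n]

/-! ### The bubbly steady state -/

/-- The difference equation in deviations from `kb`, solved for the middle term of its
linearization: `x (t + 1) = eulerMap (x t, x (t + 1), x (t + 2), d (t + 1))`. -/
noncomputable def eulerMap (E : Economy) (kb M : ℝ) (u : ℝ × ℝ × ℝ × ℝ) : ℝ :=
  u.2.1 + (deriv E.f (kb + u.2.1) * E.assetDemand (kb + u.1) (kb + u.2.1) -
    E.G * E.assetDemand (kb + u.2.1) (kb + u.2.2.1) - E.G * u.2.2.2) / M

theorem eq_eulerMap_iff (E : Economy) {kb M : ℝ} (hM : M ≠ 0) (a b c d : ℝ) :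
    b = E.eulerMap kb M (a, b, c, d) ↔
      deriv E.f (kb + b) * E.assetDemand (kb + a) (kb + b) =
        E.G * E.assetDemand (kb + b) (kb + c) + E.G * d := by
  rw [eulerMap, left_eq_add, div_eq_zero_iff, or_iff_left hM, sub_sub, sub_eq_zero]

theorem eulerMap_zero (E : Economy) {kb M : ℝ} (hRb : deriv E.f kb = E.G) :
    E.eulerMap kb M 0 = 0 := by
  simp [eulerMap, hRb]

/-- With `A`, `-B` the partial derivatives of the asset demand, the linearized equation is
`G A x₀ - M x₁ + G B x₂ = G d` where `M = G A + G B - f'' p`: it is diagonally dominant since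
`f'' < 0 < p`. -/
theorem exists_hasStrictFDerivAt_eulerMap (E : Economy) {kb A B : ℝ} (hkb : 0 < kb)
    (hRb : deriv E.f kb = E.G) {H' : ℝ × ℝ →L[ℝ] ℝ}
    (hH : HasStrictFDerivAt (fun q : ℝ × ℝ => E.assetDemand q.1 q.2) H' (kb, kb))
    (hH' : ∀ v, H' v = A * v.1 - B * v.2) {M : ℝ}
    (hM : M = E.G * A + E.G * B - deriv (deriv E.f) kb * E.assetDemand kb kb) (hM0 : M ≠ 0) :
    ∃ F' : ℝ × ℝ × ℝ × ℝ →L[ℝ] ℝ, HasStrictFDerivAt (E.eulerMap kb M) F' 0 ∧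
      ∀ u, F' u = E.G * A / M * u.1 + E.G * B / M * u.2.2.1 + -E.G / M * u.2.2.2 := by
  have p1 : HasStrictFDerivAt (fun u : ℝ × ℝ × ℝ × ℝ => u.1) _ 0 :=
    hasStrictFDerivAt_fst (𝕜 := ℝ)
  have s1 : HasStrictFDerivAt (fun u : ℝ × ℝ × ℝ × ℝ => u.2) _ 0 :=
    hasStrictFDerivAt_snd (𝕜 := ℝ)
  have p2 : HasStrictFDerivAt (fun u : ℝ × ℝ × ℝ × ℝ => u.2.1) _ 0 := s1.fst
  have s2 : HasStrictFDerivAt (fun u : ℝ × ℝ × ℝ × ℝ => u.2.2) _ 0 := s1.snd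
  have p3 : HasStrictFDerivAt (fun u : ℝ × ℝ × ℝ × ℝ => u.2.2.1) _ 0 := s2.fst
  have p4 : HasStrictFDerivAt (fun u : ℝ × ℝ × ℝ × ℝ => u.2.2.2) _ 0 := s2.snd
  have hf : HasStrictFDerivAt (fun u : ℝ × ℝ × ℝ × ℝ => deriv E.f (kb + u.2.1)) _ 0 :=
    HasStrictDerivAt.comp_hasStrictFDerivAt (h₂ := deriv E.f)
      (f := fun u : ℝ × ℝ × ℝ × ℝ => kb + u.2.1)
      0 (by simpa using E.hasStrictDerivAt_deriv_f hkb) (p2.const_add kb)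
  have h12 : HasStrictFDerivAt
      (fun u : ℝ × ℝ × ℝ × ℝ => E.assetDemand (kb + u.1) (kb + u.2.1)) _ 0 :=
    HasStrictFDerivAt.comp (g := fun q : ℝ × ℝ => E.assetDemand q.1 q.2)
      (f := fun u : ℝ × ℝ × ℝ × ℝ => (kb + u.1, kb + u.2.1)) 0 (by simpa using hH)
      ((p1.const_add kb).prodMk (p2.const_add kb))
  have h23 : HasStrictFDerivAt
      (fun u : ℝ × ℝ × ℝ × ℝ => E.assetDemand (kb + u.2.1) (kb + u.2.2.1)) _ 0 :=
    HasStrictFDerivAt.comp (g := fun q : ℝ × ℝ => E.assetDemand q.1 q.2)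
      (f := fun u : ℝ × ℝ × ℝ × ℝ => (kb + u.2.1, kb + u.2.2.1)) 0 (by simpa using hH)
      ((p2.const_add kb).prodMk (p3.const_add kb))
  refine ⟨_, p2.add ((((hf.mul h12).sub (h23.const_mul E.G)).sub (p4.const_mul E.G)).mul_const M⁻¹),
    fun u => ?_⟩
  simp [hH', hRb]
  field_simp
  rw [hM]
  ring

theorem isLocallyDeterminate_bubblyState (E : Economy) {kb Gd ε : ℝ} (hkb : 0 < kb)
    (hRb : deriv E.f kb = E.G) (hsb : 0 < E.savingRate kb) (hGd0 : 0 ≤ Gd) (hGd : Gd < E.G)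
    (hε : HasEIS E.U (E.cy kb kb) (deriv E.f kb * (E.ω kb - E.cy kb kb)) ε)
    (hbound : ε > 1 + E.G ^ 2 / deriv (deriv E.f) kb *
      (E.ω kb / (E.cy kb kb * (E.ω kb - E.cy kb kb)))) :
    E.IsLocallyDeterminate Gd kb := by
  have hG := E.G_pos
  have hp := E.assetDemand_pos hkb hsb
  have hf2 := E.f_deriv2_neg kb hkb
  obtain ⟨A, hA, B, hB, H', hH, hH'⟩ :=
    E.exists_hasStrictFDerivAt_assetDemand hkb hε (by rwa [hRb, ← sq])
  set M := E.G * A + E.G * B - deriv (deriv E.f) kb * E.assetDemand kb kb with hM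
  have hMgt : E.G * A + E.G * B < M := by nlinarith [mul_pos (neg_pos.2 hf2) hp]
  have hM0 : 0 < M := lt_trans (by positivity) hMgt
  obtain ⟨F', hF, hF'⟩ := E.exists_hasStrictFDerivAt_eulerMap hkb hRb hH hH' hM hM0.ne'
  obtain ⟨ρ, hρ, η, hη, hsum, hLip⟩ := exists_lipschitz_box hF hF' (by positivity) (by positivity)
    (by rw [← add_div]; exact (div_lt_one hM0).2 hMgt)
  have hα : 0 ≤ E.G * A / M + η := by positivity
  have hσ : 0 ≤ E.G * B / M + η := by positivity
  have hγ0 : 0 ≤ Gd / E.G := by positivity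
  have hγ1 : Gd / E.G < 1 := (div_lt_one hG).2 hGd
  refine ⟨{ξ | |ξ.1 - kb| < ρ ∧ |ξ.2.2| < ρ}, ?_, fun V hV hVV₀ => ?_⟩
  · have c1 : ContinuousAt (fun ξ : ℝ × ℝ × ℝ => |ξ.1 - kb|) (E.bubblyState kb) := by fun_prop
    have c2 : ContinuousAt (fun ξ : ℝ × ℝ × ℝ => |ξ.2.2|) (E.bubblyState kb) := by fun_prop
    exact (c1.eventually_lt_const (by simpa [bubblyState] using hρ)).and
      (c2.eventually_lt_const (by simpa [bubblyState] using hρ))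
  -- the state `(k, assetDemand k k', d)` lies in `V` if `k`, `k'`, `d` are close enough
  have hgc : ContinuousAt
      (fun u : ℝ × ℝ × ℝ => (u.1, E.assetDemand u.1 u.2.1, u.2.2)) (kb, kb, 0) := by
    have hHc : ContinuousAt (fun u : ℝ × ℝ × ℝ => E.assetDemand u.1 u.2.1) (kb, kb, 0) :=
      ContinuousAt.comp (g := fun q : ℝ × ℝ => E.assetDemand q.1 q.2)
        (f := fun u : ℝ × ℝ × ℝ => (u.1, u.2.1)) (x := (kb, kb, 0)) hH.continuousAt (by fun_prop)
    exact continuousAt_fst.prodMk (hHc.prodMk (by fun_prop))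
  have hgV := hgc.eventually hV
  have hgk : ∀ᶠ u : ℝ × ℝ × ℝ in 𝓝 (kb, kb, 0), 0 < u.1 := continuousAt_fst.eventually_const_lt hkb
  have hgp : ∀ᶠ u : ℝ × ℝ × ℝ in 𝓝 (kb, kb, 0), 0 < E.assetDemand u.1 u.2.1 :=
    (continuousAt_fst.comp (continuousAt_snd.comp hgc)).eventually_const_lt hp
  obtain ⟨r₀, hr₀, hball⟩ := Metric.nhds_basis_closedBall.eventually_iff.1 (hgV.and (hgk.and hgp))
  set r := min r₀ ρ
  have hr : 0 < r := lt_min hr₀ hρ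
  obtain ⟨δ, hδ, hsol⟩ := exists_decaying_solution hα hη.le hσ (by positivity) hsum hγ0 hγ1 hρ
    hLip (E.eulerMap_zero hRb) hr (min_le_right _ _)
  have hz : ∀ᶠ z : ℝ × ℝ in 𝓝 (kb, 0), |z.1 - kb| < δ ∧ |z.2 / E.N₀| < min δ r := by
    have c1 : ContinuousAt (fun z : ℝ × ℝ => |z.1 - kb|) (kb, 0) := by fun_prop
    have c2 : ContinuousAt (fun z : ℝ × ℝ => |z.2 / E.N₀|) (kb, 0) := by fun_prop
    exact (c1.eventually_lt_const (by simpa using hδ)).and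
      (c2.eventually_lt_const (by simpa using ⟨hδ, hr⟩))
  filter_upwards [hz] with z ⟨hz1, hz2⟩
  obtain ⟨x, hx0, hxr, hxlim, hx⟩ := hsol _ _ hz1 (hz2.trans_le (min_le_left _ _))
  have hd : ∀ t, |z.2 / E.N₀ * (Gd / E.G) ^ t| ≤ r := fun t => by
    rw [abs_mul, abs_of_nonneg (pow_nonneg hγ0 t)]
    exact (mul_le_of_le_one_right (abs_nonneg _) (pow_le_one₀ hγ0 hγ1.le)).trans
      (hz2.le.trans (min_le_right _ _))
  have hdlim : Tendsto (fun t => z.2 / E.N₀ * (Gd / E.G) ^ t) atTop (𝓝 0) := by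
    simpa using (tendsto_pow_atTop_nhds_zero_of_lt_one hγ0 hγ1).const_mul (z.2 / E.N₀)
  have hmem : ∀ t, (kb + x t, kb + x (t + 1), z.2 / E.N₀ * (Gd / E.G) ^ t) ∈
      Metric.closedBall (kb, kb, (0 : ℝ)) r₀ := fun t => by
    have h1 := (hxr t).trans (min_le_left _ _)
    have h2 := (hxr (t + 1)).trans (min_le_left _ _)
    have h3 := (hd t).trans (min_le_left _ _)
    simp only [mem_closedBall_iff_norm, Prod.norm_def, Prod.fst_sub, Prod.snd_sub,
      add_sub_cancel_left, sub_zero, Real.norm_eq_abs, max_le_iff]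
    exact ⟨h1, h2, h3⟩
  refine ⟨E.pathOfCapital Gd z.2 (fun t => kb + x t), ⟨?_, ?_, ?_, fun t => ?_, ?_⟩, ?_⟩
  · exact E.isEquilibrium_pathOfCapital (fun t => (hball (hmem t)).2.1)
      (fun t => (hball (hmem t)).2.2.le) fun t => (E.eq_eulerMap_iff hM0.ne' _ _ _ _).1 (hx t)
  · simp [pathOfCapital, hx0]
  · simp [pathOfCapital]
  · rw [ξ_pathOfCapital]
    exact (hball (hmem t)).1
  · have hklim : Tendsto (fun t => kb + x t) atTop (𝓝 kb) := by simpa using hxlim.const_add kb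
    have h := hgc.tendsto.comp
      (hklim.prodMk_nhds ((hklim.comp (tendsto_add_atTop_nat 1)).prodMk_nhds hdlim))
    exact h.congr fun t => (E.ξ_pathOfCapital Gd z.2 _ t).symm
  · rintro y ⟨hy, hy0, hyD, hyV, -⟩
    have hyk : (fun t => y.k t - kb) = x := by
      refine solution_unique hα hη.le hσ hsum hLip
        (d := fun t => z.2 / E.N₀ * (Gd / E.G) ^ t) (fun t => (hd t).trans (min_le_right _ _))
        (fun t => (hVV₀ (hyV t)).1.le) (fun t => (hxr t).trans (min_le_right _ _))
        (by rw [hx0, hy0]) (fun t => (E.eq_eulerMap_iff hM0.ne' _ _ _ _).2 ?_) hx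
      simpa only [add_sub_cancel, hyD] using hy.euler t
    rw [hy.ext_capital, hyD]
    congr 1
    ext t
    rw [← hyk]
    ring

end Economy

theorem theorem2 (E : Economy) (kf kb Gd : ℝ)
    (hkf : 0 < kf) (hsf : E.savingRate kf = 0)
    (hRf : deriv E.f kf < E.G)
    (hkb : 0 < kb) (hRb : deriv E.f kb = E.G)
    (hsb : 0 < E.savingRate kb)
    (hGd : Gd ∈ Ioo (deriv E.f kf) E.G) :
    (¬ ∃ x : Economy.Path, E.IsEquilibrium Gd x ∧ 0 < x.D 0 ∧
        Tendsto (E.ξ x) atTop (𝓝 (Economy.fundamentalState kf))) ∧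
    (∀ ε : ℝ,
      HasEIS E.U (E.cy kb kb) (deriv E.f kb * (E.ω kb - E.cy kb kb)) ε →
      ε > 1 + E.G ^ 2 / deriv (deriv E.f) kb *
        (E.ω kb / (E.cy kb kb * (E.ω kb - E.cy kb kb))) →
      E.IsLocallyDeterminate Gd kb) := by
  constructor
  · rintro ⟨x, hx, hD, hlim⟩
    exact E.not_tendsto_of_deriv_lt hkf hGd.1 hx hD (continuous_fst.continuousAt.tendsto.comp hlim)
  · intro ε hε hbound
    exact E.isLocallyDeterminate_bubblyState hkb hRb hsb
      ((E.f_deriv_pos kf hkf).trans hGd.1).le hGd.2 hε hbound
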